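/- For $n\ge 1$ let $B_n=\{0,1\}^n$, and for $X=(x_1,\dots,x_n)\in B_n$ let $|X|=\sum_{i=1}^n x_i$ and $a_X=|X|/n$. A quantum algorithm with $T$ queries acts on the state space of finitely many qubits, divided into an index register, one target qubit and a workspace. It starts in a unit vector $|\psi_0\rangle$ and on input $X$ prepares the state $U_TQ_XU_{T-1}Q_X\cdots U_1Q_XU_0|\psi_0\rangle$, where $|\psi_0\rangle$ and the unitary operators $U_0,\dots,U_T$ do not depend on $X$, and the query $Q_X$ is the unitary operator that maps a computational basis state $|i,b,z\rangle$ to $|i,b\oplus x_i,z\rangle$ if $i$ is one of the $n$ indices, and to itself otherwise. A quantum measurement with finitely many outcomes, which does not depend on $X$, is applied to this state; outcome $j$ occurs with probability $p_X(j)$, and the algorithm then returns a real number $\hat a(j)$ as an approximation of $a_X$, and $n\,\hat a(j)$ as an approximation of the count $|X|$. For $1\le q<\infty$ the worst expected error of the algorithm for the count is $$e_1^{\rm we}(q,B_n,T)=n\cdot\max_{X\in B_n}\Bigl(\sum_j |a_X-\hat a(j)|^q\,p_X(j)\Bigr)^{1/q}.$$ Then there is an absolute constant $c>0$ such that for all $q\in[1,\infty)$,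 all $n\ge1$ and all real $\Delta$ with $0<\Delta<n/2$, every quantum algorithm with $T$ queries and $e_1^{\rm we}(q,B_n,T)\le\Delta$ satisfies $$T\ \ge\ c\,\min\{n/\Delta,\;n\}.$$ -/

import Mathlib

noncomputable section

namespace QuantumCount

/-- `B_n = {0,1}^n`: the tuples `X = (x_1, …, x_n)` of `n` Boolean variables. -/
abbrev Input (n : ℕ) : Type := Fin n → Bool

/-- The number of ones `|X| = ∑ x_i`. -/
def weight {n : ℕ} (X : Input n) : ℕ := ∑ i, (X i).toNat

/-- The Boolean mean `a_X = |X| / n`. -/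
def mean {n : ℕ} (X : Input n) : ℝ := (weight X : ℝ) / (n : ℝ)

/-- Labels `(i, b, z)` of the computational basis of `a + 1 + w` qubits: an index register `i` of
`a` qubits, a target qubit `b` and a workspace `z` of `w` qubits. -/
abbrev BasisLabel (a w : ℕ) : Type := Fin (2 ^ a) × Bool × Fin (2 ^ w)

/-- The state space `ℂ² ⊗ ⋯ ⊗ ℂ²` of `a + 1 + w` qubits, in coordinates with respect to the
computational basis. -/
abbrev StateSpace (a w : ℕ) : Type := EuclideanSpace ℂ (BasisLabel a w)

/-- The effect of a query on labels: `(i, b, z) ↦ (i, b ⊕ x_i, z)` if `i` is one of the `n` indices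
(numbered from `0`); every other label is left fixed. -/
def queryLabel {n : ℕ} (X : Input n) (a w : ℕ) (s : BasisLabel a w) : BasisLabel a w :=
  (s.1, (if h : (s.1 : ℕ) < n then xor s.2.1 (X ⟨s.1, h⟩) else s.2.1), s.2.2)

theorem queryLabel_involutive {n : ℕ} (X : Input n) (a w : ℕ) :
    Function.Involutive (queryLabel X a w) := by
  rintro ⟨i, b, z⟩
  by_cases h : (i : ℕ) < n <;> simp [queryLabel, h]

/-- The query operator `Q_X`: the unitary operator that permutes the computational basis
by `|i, b, z⟩ ↦ |i, b ⊕ x_i, z⟩`. -/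
def query {n : ℕ} (X : Input n) (a w : ℕ) : StateSpace a w ≃ₗᵢ[ℂ] StateSpace a w :=
  LinearIsometryEquiv.piLpCongrLeft 2 ℂ ℂ (queryLabel_involutive X a w).toPerm

/-- A quantum algorithm with `T` queries to an input in `{0,1}^n`, which makes one measurement at
the end and returns a real number. Nothing in it depends on the input. -/
structure Algorithm (n T : ℕ) where
  /-- number of qubits of the index register -/
  a : ℕ
  /-- number of workspace qubits -/
  w : ℕ
  /-- the unitary transformations `U_0, …, U_T` -/
  U : Fin (T + 1) → (StateSpace a w ≃ₗᵢ[ℂ] StateSpace a w)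
  /-- the initial state `|ψ_0⟩` -/
  init : StateSpace a w
  norm_init : ‖init‖ = 1
  /-- the number of outcomes of the measurement -/
  M : ℕ
  /-- the measurement operators (an arbitrary quantum measurement) -/
  meas : Fin M → (StateSpace a w →L[ℂ] StateSpace a w)
  meas_complete : ∑ j, (ContinuousLinearMap.adjoint (meas j)) ∘L (meas j)
    = ContinuousLinearMap.id ℂ (StateSpace a w)
  /-- the approximation `â(j)` of the mean that is returned on outcome `j` -/
  estimate : Fin M → ℝ

namespace Algorithm

variable {n T : ℕ}

/-- The state `U_t Q_X U_{t-1} Q_X ⋯ U_1 Q_X U_0 |ψ_0⟩`. -/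
def stateAt (A : Algorithm n T) (X : Input n) : (t : ℕ) → t < T + 1 → StateSpace A.a A.w
  | 0, h => A.U ⟨0, h⟩ A.init
  | t + 1, h => A.U ⟨t + 1, h⟩ (query X A.a A.w (A.stateAt X t (Nat.lt_of_succ_lt h)))

/-- The final state `|ψ⟩ = U_T Q_X U_{T-1} Q_X ⋯ U_1 Q_X U_0 |ψ_0⟩`. -/
def finalState (A : Algorithm n T) (X : Input n) : StateSpace A.a A.w :=
  A.stateAt X T (Nat.lt_succ_self T)

/-- The probability `p_X(j)` of the outcome `j` on input `X`. -/
def prob (A : Algorithm n T) (X : Input n) (j : Fin A.M) : ℝ :=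
  ‖A.meas j (A.finalState X)‖ ^ 2

/-- The expected error `(∑_j |a_X - â(j)|^q p_X(j))^{1/q}` on input `X`. -/
def expectedError (A : Algorithm n T) (q : ℝ) (X : Input n) : ℝ :=
  (∑ j, |mean X - A.estimate j| ^ q * A.prob X j) ^ (1 / q)

/-- The worst expected error for the mean: the maximum of the expected error over all inputs. -/
def worstExpectedError (A : Algorithm n T) (q : ℝ) : ℝ :=
  Finset.univ.sup' Finset.univ_nonempty (fun X : Input n => A.expectedError q X)

/-- The worst expected error for the count, where `n * â(j)` approximates `|X|`:
`n` times the worst expected error for the mean. -/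
def worstExpectedCountError (A : Algorithm n T) (q : ℝ) : ℝ :=
  (n : ℝ) * A.worstExpectedError q

end Algorithm

end QuantumCount

end

/-! This is an adversary argument on block inputs. Cut `n / d` blocks of length `d = ⌈32 * Δ⌉₊` out
of the positions and let `N = n / d` bits set whole blocks. Flipping one bit moves the mean by at
least `d / n`, so an accurate algorithm must bring the two final states to overlap at most `1 / 2`
(`re_inner_finalState_le`). Sum the overlaps over all inputs and all flips: the sum starts at `2 ^ N
* N` and must end at no more than half of that. The blocks are disjoint, so one query, made in
superposition, lowers it by at most `2 * 2 ^ N` (`overlapSum_le_succ`). Hence `N ≤ 4 * T`. Since `N`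
may be `0`, the bound `T ≥ 1` is proved separately (`queries_pos`). -/

namespace QuantumCount

/-! ### Effect of one query on the overlap of two states. -/

/-- The labels whose index register addresses a position at which `X` and `Y` differ. -/
def DiffersAt {n : ℕ} (X Y : Input n) (i : ℕ) : Prop :=
  ∃ h : i < n, X ⟨i, h⟩ ≠ Y ⟨i, h⟩

theorem query_apply {n : ℕ} (X : Input n) (a w : ℕ) (u : StateSpace a w) (s : BasisLabel a w) :
    query X a w u s = u (queryLabel X a w s) := by
  rfl

theorem queryLabel_comp_of_not_differsAt {n : ℕ} (X Y : Input n) (a w : ℕ) (s : BasisLabel a w)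
    (h : ¬ DiffersAt X Y s.1) : queryLabel Y a w (queryLabel X a w s) = s := by
  obtain ⟨i, b, z⟩ := s
  by_cases hi : (i : ℕ) < n
  · have : X ⟨i, hi⟩ = Y ⟨i, hi⟩ := by
      by_contra hne
      exact h ⟨hi, hne⟩
    simp [queryLabel, hi, this]
  · simp [queryLabel, hi]

open Classical in
/-- The squared norm of the component of `u` whose index register satisfies `P`. -/
noncomputable def indexMass {a w : ℕ} (P : ℕ → Prop) (u : StateSpace a w) : ℝ :=
  ∑ s, if P (s.1 : ℕ) then ‖u s‖ ^ 2 else 0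

theorem indexMass_query {n : ℕ} (X : Input n) {a w : ℕ} (P : ℕ → Prop) (u : StateSpace a w) :
    indexMass P (query X a w u) = indexMass P u := by
  classical
  unfold indexMass
  simp only [query_apply]
  exact Equiv.sum_comp (queryLabel_involutive X a w).toPerm
    (fun s : BasisLabel a w => if P (s.1 : ℕ) then ‖u s‖ ^ 2 else 0)

theorem sum_indexMass_le {ι : Type*} [Fintype ι] {a w : ℕ} (P : ι → ℕ → Prop)
    (hP : ∀ i j k, P i k → P j k → i = j) (u : StateSpace a w) :
    ∑ i, indexMass (P i) u ≤ ‖u‖ ^ 2 := by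
  classical
  unfold indexMass
  rw [Finset.sum_comm, EuclideanSpace.norm_sq_eq]
  refine Finset.sum_le_sum fun s _ => ?_
  by_cases h : ∃ i, P i s.1
  · obtain ⟨i, hi⟩ := h
    rw [Finset.sum_eq_single i]
    · simp [hi]
    · intro j _ hj
      rw [if_neg]
      exact fun hjs => hj (hP _ _ _ hjs hi)
    · simp
  · push Not at h
    simp only [h, if_false, Finset.sum_const_zero]
    positivity

/-- As the query on `X` is a self-inverse isometry, both queries can be moved onto `v`. Their
composite fixes every coordinate whose index does not separate `X` from `Y`, so only the mass on
separating indices matters. -/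
theorem abs_re_inner_query_sub_le {n : ℕ} (X Y : Input n) {a w : ℕ} (u v : StateSpace a w) :
    |(inner ℂ (query X a w u) (query Y a w v)).re - (inner ℂ u v).re|
      ≤ indexMass (DiffersAt X Y) u + indexMass (DiffersAt X Y) v := by
  classical
  set v' : StateSpace a w := query X a w (query Y a w v) with hv'
  have hXX : ∀ x : StateSpace a w, query X a w (query X a w x) = x := by
    intro x
    ext s
    simp only [query_apply]
    rw [queryLabel_involutive X a w s]
  have h1 : inner ℂ (query X a w u) (query Y a w v) = inner ℂ u v' := by
    rw [← (query X a w).inner_map_map u v', hv', hXX]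
  have hmass : indexMass (DiffersAt X Y) v' = indexMass (DiffersAt X Y) v := by
    rw [hv', indexMass_query, indexMass_query]
  have h2 : |(inner ℂ u v').re - (inner ℂ u v).re| ≤
      ∑ s : BasisLabel a w, if DiffersAt X Y s.1 then ‖u s‖ * ‖v' s - v s‖ else 0 := by
    rw [← Complex.sub_re, ← inner_sub_right]
    refine (Complex.abs_re_le_norm _).trans ?_
    rw [PiLp.inner_apply]
    refine (norm_sum_le _ _).trans (Finset.sum_le_sum fun s _ => ?_)
    split_ifs with hs
    · rw [mul_comm]
      simp [mul_comm]
    · have : v' s = v s := by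
        rw [hv', query_apply, query_apply, queryLabel_comp_of_not_differsAt X Y a w s hs]
      simp [this]
  rw [h1]
  refine h2.trans ?_
  have h3 : (∑ s : BasisLabel a w, if DiffersAt X Y s.1 then ‖u s‖ * ‖v' s - v s‖ else 0)
      ≤ indexMass (DiffersAt X Y) u + (indexMass (DiffersAt X Y) v'
        + indexMass (DiffersAt X Y) v) / 2 := by
    unfold indexMass
    rw [← Finset.sum_add_distrib, Finset.sum_div, ← Finset.sum_add_distrib]
    -- Per coordinate: the triangle inequality for `v' s - v s`, then AM-GM on each product.
    refine Finset.sum_le_sum fun s _ => ?_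
    split_ifs
    · have := norm_sub_le (v' s) (v s)
      have hu := norm_nonneg (u s)
      nlinarith [mul_le_mul_of_nonneg_left this hu, sq_nonneg (‖u s‖ - ‖v' s‖),
        sq_nonneg (‖u s‖ - ‖v s‖)]
    · simp
  rw [hmass] at h3
  linarith

/-! ### What accuracy forces on the final states. -/

namespace Algorithm

variable {n T : ℕ} (A : Algorithm n T)

theorem norm_stateAt (X : Input n) (t : ℕ) (ht : t < T + 1) : ‖A.stateAt X t ht‖ = 1 := by
  induction t with
  | zero => simp [stateAt, A.norm_init]
  | succ t ih => simp [stateAt, ih]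

theorem norm_finalState (X : Input n) : ‖A.finalState X‖ = 1 := A.norm_stateAt X _ _

theorem sum_inner_meas (u v : StateSpace A.a A.w) :
    ∑ j, inner ℂ (A.meas j u) (A.meas j v) = inner ℂ u v := by
  have h := congrArg (fun L : StateSpace A.a A.w →L[ℂ] StateSpace A.a A.w => inner ℂ u (L v))
    A.meas_complete
  simp only [_root_.sum_apply, inner_sum, ContinuousLinearMap.comp_apply,
    ContinuousLinearMap.adjoint_inner_right, ContinuousLinearMap.id_apply] at h
  exact h

theorem prob_nonneg (X : Input n) (j : Fin A.M) : 0 ≤ A.prob X j := by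
  unfold prob
  positivity

theorem sum_prob (X : Input n) : ∑ j, A.prob X j = 1 := by
  have h := congrArg Complex.re (A.sum_inner_meas (A.finalState X) (A.finalState X))
  rw [Complex.re_sum] at h
  have h' : ∀ u : StateSpace A.a A.w, (inner ℂ u u).re = ‖u‖ ^ 2 := fun u =>
    inner_self_eq_norm_sq (𝕜 := ℂ) u
  simp only [h', A.norm_finalState] at h
  simpa [prob] using h

theorem sum_rpow_nonneg (q : ℝ) (X : Input n) :
    0 ≤ ∑ j, |mean X - A.estimate j| ^ q * A.prob X j :=
  Finset.sum_nonneg fun j _ => mul_nonneg (by positivity) (A.prob_nonneg X j)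

theorem expectedError_le_of_worst {q Δ : ℝ} (hn : 0 < n)
    (h : A.worstExpectedCountError q ≤ Δ) (X : Input n) : A.expectedError q X ≤ Δ / n := by
  have hn' : (0 : ℝ) < n := by exact_mod_cast hn
  have h1 : A.expectedError q X ≤ A.worstExpectedError q :=
    Finset.le_sup' (fun X : Input n => A.expectedError q X) (Finset.mem_univ X)
  rw [le_div_iff₀ hn']
  unfold worstExpectedCountError at h
  nlinarith

theorem sum_rpow_le {q e : ℝ} (hq : 1 ≤ q) (X : Input n) (h : A.expectedError q X ≤ e) :
    ∑ j, |mean X - A.estimate j| ^ q * A.prob X j ≤ e ^ q := by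
  have h0 := A.sum_rpow_nonneg q X
  have h1 := Real.rpow_le_rpow (Real.rpow_nonneg h0 _) h (by linarith : (0 : ℝ) ≤ q)
  rwa [← Real.rpow_mul h0, one_div_mul_cancel (by linarith), Real.rpow_one] at h1

theorem sum_abs_le {q e : ℝ} (hq : 1 ≤ q) (X : Input n) (h : A.expectedError q X ≤ e) :
    ∑ j, A.prob X j * |mean X - A.estimate j| ≤ e := by
  refine le_trans ?_ h
  have := Real.arith_mean_le_rpow_mean Finset.univ (fun j => A.prob X j)
    (fun j => |mean X - A.estimate j|) (fun j _ => A.prob_nonneg X j) (A.sum_prob X)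
    (fun j _ => abs_nonneg _) hq
  refine this.trans (le_of_eq ?_)
  unfold expectedError
  simp only [mul_comm]

/-- As the means are `2 * r` apart, every outcome is off by at least `r` for one of the two inputs.
By a Markov bound such outcomes have probability at most `(e / r) ^ q ≤ 1 / 16` on that input.
Weighted AM-GM turns this into overlap at most `1/8 + 1/8 + 2/16 + 2/16 = 1/2`. -/
theorem re_inner_finalState_le {q e r : ℝ} (hq : 1 ≤ q) (X Y : Input n) (he : 0 ≤ e) (hr : 0 < r)
    (her : 16 * e ≤ r) (hX : A.expectedError q X ≤ e) (hY : A.expectedError q Y ≤ e)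
    (hXY : 2 * r ≤ |mean X - mean Y|) :
    (inner ℂ (A.finalState X) (A.finalState Y)).re ≤ 1 / 2 := by
  have hrq : 0 < r ^ q := Real.rpow_pos_of_pos hr q
  have hpow : e ^ q ≤ r ^ q / 16 := by
    have h1 : (e / r) ^ q ≤ e / r := by
      have h01 : e / r ≤ 1 := by rw [div_le_one hr]; linarith
      have := Real.rpow_le_rpow_of_exponent_ge' (div_nonneg he hr.le) h01 zero_le_one hq
      rwa [Real.rpow_one] at this
    rw [Real.div_rpow he hr.le] at h1
    have h2 : e / r ≤ 1 / 16 := by rw [div_le_iff₀ hr]; linarith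
    have h3 := h1.trans h2
    rw [div_le_iff₀ hrq] at h3
    linarith
  have hX' := (A.sum_rpow_le hq X hX).trans hpow
  have hY' := (A.sum_rpow_le hq Y hY).trans hpow
  rw [← A.sum_inner_meas, Complex.re_sum]
  have key : ∀ j, (inner ℂ (A.meas j (A.finalState X)) (A.meas j (A.finalState Y))).re ≤
      A.prob X j / 8 + A.prob Y j / 8
        + 2 * ((|mean X - A.estimate j| ^ q * A.prob X j) / r ^ q)
        + 2 * ((|mean Y - A.estimate j| ^ q * A.prob Y j) / r ^ q) := by
    intro j
    have h1 : (inner ℂ (A.meas j (A.finalState X)) (A.meas j (A.finalState Y))).re ≤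
        ‖A.meas j (A.finalState X)‖ * ‖A.meas j (A.finalState Y)‖ :=
      (Complex.re_le_norm _).trans (norm_inner_le_norm _ _)
    refine h1.trans ?_
    have hpX := A.prob_nonneg X j
    have hpY := A.prob_nonneg Y j
    have h8 : ‖A.meas j (A.finalState X)‖ * ‖A.meas j (A.finalState Y)‖ ≤
        2 * A.prob X j + A.prob Y j / 8 := by
      unfold prob
      nlinarith [sq_nonneg (4 * ‖A.meas j (A.finalState X)‖ - ‖A.meas j (A.finalState Y)‖)]
    have h8' : ‖A.meas j (A.finalState X)‖ * ‖A.meas j (A.finalState Y)‖ ≤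
        2 * A.prob Y j + A.prob X j / 8 := by
      unfold prob
      nlinarith [sq_nonneg (4 * ‖A.meas j (A.finalState Y)‖ - ‖A.meas j (A.finalState X)‖)]
    have bad : ∀ Z : Input n, r ≤ |mean Z - A.estimate j| →
        A.prob Z j ≤ (|mean Z - A.estimate j| ^ q * A.prob Z j) / r ^ q := by
      intro Z hZ
      rw [le_div_iff₀ hrq, mul_comm]
      exact mul_le_mul_of_nonneg_right (Real.rpow_le_rpow hr.le hZ (by linarith))
        (A.prob_nonneg Z j)
    have hnn : ∀ Z : Input n, 0 ≤ (|mean Z - A.estimate j| ^ q * A.prob Z j) / r ^ q := fun Z =>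
      div_nonneg (mul_nonneg (by positivity) (A.prob_nonneg Z j)) hrq.le
    have hX0 := hnn X
    have hY0 := hnn Y
    by_cases hb : r ≤ |mean X - A.estimate j|
    · have := bad X hb
      linarith
    · have hb' : r ≤ |mean Y - A.estimate j| := by
        have := abs_sub_le (mean X) (A.estimate j) (mean Y)
        rw [abs_sub_comm (A.estimate j) (mean Y)] at this
        linarith
      have := bad Y hb'
      linarith
  refine (Finset.sum_le_sum fun j _ => key j).trans ?_
  simp only [Finset.sum_add_distrib, ← Finset.mul_sum, ← Finset.sum_div, A.sum_prob]
  have hX2 := (div_le_iff₀ hrq).2 (hX'.trans (by linarith : r ^ q / 16 ≤ 1 / 16 * r ^ q))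
  have hY2 := (div_le_iff₀ hrq).2 (hY'.trans (by linarith : r ^ q / 16 ≤ 1 / 16 * r ^ q))
  linarith

end Algorithm

/-! ### Block inputs and their means. -/

/-- Flip the bit at position `i`. -/
def flip {N : ℕ} (i : Fin N) (x : Input N) : Input N := Function.update x i (!(x i))

theorem flip_involutive {N : ℕ} (i : Fin N) : Function.Involutive (flip i) := by
  intro x
  simp [flip]

/-- Repeat every bit of `x` in a block of `d` consecutive positions; the positions behind the last
block are `0`. -/
def repeatBits {N : ℕ} (n d : ℕ) (x : Input N) : Input n :=
  fun k => if h : (k : ℕ) / d < N then x ⟨k / d, h⟩ else false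

theorem differsAt_repeatBits_flip {N n d : ℕ} (i : Fin N) (x : Input N) (k : ℕ)
    (h : DiffersAt (repeatBits n d x) (repeatBits n d (flip i x)) k) : k / d = i := by
  obtain ⟨hk, hne⟩ := h
  by_contra hki
  apply hne
  unfold repeatBits flip
  by_cases h : k / d < N
  · have : (⟨k / d, h⟩ : Fin N) ≠ i := fun h' => hki (congrArg Fin.val h')
    simp [h, this]
  · simp [h]

theorem weight_add_le_of_flip {N n d : ℕ} (hd : 0 < d) (hN : N * d ≤ n) (i : Fin N) (x : Input N)
    (hx : x i = false) :
    weight (repeatBits n d x) + d ≤ weight (repeatBits n d (flip i x)) := by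
  classical
  unfold weight
  have hcard : d ≤ (Finset.univ.filter fun k : Fin n => (k : ℕ) / d = i).card := by
    have hlt : ∀ k : Fin d, (i : ℕ) * d + k < n := fun k => by
      have : ((i : ℕ) + 1) * d ≤ N * d := Nat.mul_le_mul_right d i.2
      have hk := k.2
      nlinarith
    have := Finset.card_le_card_of_injOn (s := (Finset.univ : Finset (Fin d)))
      (t := Finset.univ.filter fun k : Fin n => (k : ℕ) / d = i)
      (fun k : Fin d => (⟨(i : ℕ) * d + k, hlt k⟩ : Fin n))
      (by
        intro k _
        simp only [Finset.coe_filter, Finset.mem_univ, true_and, Set.mem_ofPred_eq]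
        rw [mul_comm, Nat.mul_add_div hd, Nat.div_eq_of_lt k.2, add_zero])
      (by
        intro k _ l _ hkl
        simp only [Fin.mk.injEq] at hkl
        exact Fin.ext (by omega))
    simpa using this
  calc _ ≤ ∑ k, (repeatBits n d x k).toNat + ∑ k : Fin n, (if (k : ℕ) / d = i then 1 else 0) := by
        rw [← Finset.card_filter]
        exact Nat.add_le_add_left hcard _
    _ ≤ _ := by
        rw [← Finset.sum_add_distrib]
        refine Finset.sum_le_sum fun k _ => ?_
        unfold repeatBits flip
        by_cases hk : (k : ℕ) / d = i
        · have h : (k : ℕ) / d < N := hk ▸ i.2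
          have h' : (⟨(k : ℕ) / d, h⟩ : Fin N) = i := Fin.ext hk
          simp [hk, hx]
        · by_cases h : (k : ℕ) / d < N
          · have : (⟨(k : ℕ) / d, h⟩ : Fin N) ≠ i := fun h' => hk (congrArg Fin.val h')
            simp [h, this, hk]
          · simp [h, hk]

theorem le_abs_mean_sub_mean_flip {N n d : ℕ} (hd : 0 < d) (hN : N * d ≤ n) (i : Fin N)
    (x : Input N) :
    (d : ℝ) / n ≤ |mean (repeatBits n d x) - mean (repeatBits n d (flip i x))| := by
  have key : ∀ y : Input N, y i = false →
      (d : ℝ) / n ≤ mean (repeatBits n d (flip i y)) - mean (repeatBits n d y) := by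
    intro y hy
    have h : ((weight (repeatBits n d y) : ℝ) + d) ≤ weight (repeatBits n d (flip i y)) := by
      exact_mod_cast weight_add_le_of_flip hd hN i y hy
    unfold mean
    rw [← sub_div]
    exact div_le_div_of_nonneg_right (by linarith) (Nat.cast_nonneg n)
  cases hx : x i
  · rw [abs_sub_comm]
    exact (key x hx).trans (le_abs_self _)
  · have := key (flip i x) (by simp [flip, hx])
    rw [flip_involutive i x] at this
    exact this.trans (le_abs_self _)

/-! ### Decay of the total overlap. -/

namespace Algorithm

variable {n T : ℕ} (A : Algorithm n T)

/-- The sum of the overlaps of the states at time `t` over all inputs `x` and all flips of `x`. -/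
noncomputable def overlapSum (N d t : ℕ) (ht : t < T + 1) : ℝ :=
  ∑ x : Input N, ∑ i : Fin N, (inner ℂ (A.stateAt (repeatBits n d x) t ht)
    (A.stateAt (repeatBits n d (flip i x)) t ht)).re

theorem overlapSum_zero (N d : ℕ) : A.overlapSum N d 0 (Nat.succ_pos T) = 2 ^ N * N := by
  simp [overlapSum, stateAt, A.norm_init]

theorem overlapSum_le_succ (N d t : ℕ) (ht : t + 1 < T + 1) :
    A.overlapSum N d t (Nat.lt_of_succ_lt ht) - 2 * 2 ^ N ≤ A.overlapSum N d (t + 1) ht := by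
  classical
  set ψ : Input N → StateSpace A.a A.w :=
    fun x => A.stateAt (repeatBits n d x) t (Nat.lt_of_succ_lt ht) with hψ
  set m : Fin N → Input N → ℝ := fun i x => indexMass (fun k => k / d = i) (ψ x) with hm
  have hmono : ∀ (P Q : ℕ → Prop) (u : StateSpace A.a A.w), (∀ k, P k → Q k) →
      indexMass P u ≤ indexMass Q u := by
    intro P Q u h
    refine Finset.sum_le_sum fun s _ => ?_
    by_cases hp : P s.1
    · simp [hp, h _ hp]
    · rw [if_neg hp]
      split_ifs <;> positivity
  have hstep : ∀ x i, (inner ℂ (ψ x) (ψ (flip i x))).re - (m i x + m i (flip i x)) ≤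
      (inner ℂ (A.stateAt (repeatBits n d x) (t + 1) ht)
        (A.stateAt (repeatBits n d (flip i x)) (t + 1) ht)).re := by
    intro x i
    simp only [stateAt, LinearIsometryEquiv.inner_map_map]
    have h := abs_re_inner_query_sub_le (repeatBits n d x) (repeatBits n d (flip i x))
      (ψ x) (ψ (flip i x))
    have h1 := hmono _ _ (ψ x) (differsAt_repeatBits_flip (n := n) (d := d) i x)
    have h2 := hmono _ _ (ψ (flip i x)) (differsAt_repeatBits_flip (n := n) (d := d) i x)
    have h3 := (abs_le.1 h).1
    simp only [hm]
    linarith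
  have hmass : ∑ x, ∑ i, m i x ≤ (2 : ℝ) ^ N := by
    have : ∀ x, ∑ i, m i x ≤ 1 := by
      intro x
      have := sum_indexMass_le (fun (i : Fin N) k => k / d = i)
        (fun i j k hi hj => Fin.ext (hi.symm.trans hj)) (ψ x)
      simpa [hψ, A.norm_stateAt] using this
    refine (Finset.sum_le_sum fun x _ => this x).trans ?_
    simp
  -- For fixed `i`, `flip i` permutes the inputs, so both endpoints of the flips contribute the same
  -- total mass.
  have hflip : ∑ x, ∑ i, m i (flip i x) = ∑ x, ∑ i, m i x := by
    rw [Finset.sum_comm, Finset.sum_comm (γ := Input N)]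
    exact Finset.sum_congr rfl fun i _ => Equiv.sum_comp (flip_involutive i).toPerm (m i)
  have := Finset.sum_le_sum fun x (_ : x ∈ (Finset.univ : Finset (Input N))) =>
    Finset.sum_le_sum fun i (_ : i ∈ (Finset.univ : Finset (Fin N))) => hstep x i
  simp only [Finset.sum_sub_distrib, Finset.sum_add_distrib, hflip] at this
  unfold overlapSum
  linarith

theorem le_overlapSum (N d t : ℕ) (ht : t < T + 1) :
    2 ^ N * (N : ℝ) - 2 * 2 ^ N * t ≤ A.overlapSum N d t ht := by
  induction t with
  | zero => simp [A.overlapSum_zero]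
  | succ t ih =>
    have h1 := ih (Nat.lt_of_succ_lt ht)
    have h2 := A.overlapSum_le_succ N d t ht
    push_cast
    linarith

theorem numBlocks_le_queries {q e : ℝ} {N d : ℕ} (hq : 1 ≤ q) (hd : 0 < d) (hn : 0 < n)
    (hN : N * d ≤ n) (he : 0 ≤ e) (hed : 32 * e ≤ d / n) (hA : ∀ X, A.expectedError q X ≤ e) :
    (N : ℝ) ≤ 4 * T := by
  have hr : (0 : ℝ) < d / n / 2 := by positivity
  have hend : A.overlapSum N d T (Nat.lt_succ_self T) ≤ 2 ^ N * N / 2 := by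
    have : ∀ (x : Input N) (i : Fin N),
        (inner ℂ (A.finalState (repeatBits n d x)) (A.finalState (repeatBits n d (flip i x)))).re
          ≤ 1 / 2 := fun x i =>
      A.re_inner_finalState_le hq _ _ he hr (by linarith) (hA _) (hA _)
        (by linarith [le_abs_mean_sub_mean_flip hd hN i x])
    refine (Finset.sum_le_sum fun x _ => Finset.sum_le_sum fun i _ => this x i).trans ?_
    simp [div_eq_mul_inv, mul_assoc]
  have h := (A.le_overlapSum N d T (Nat.lt_succ_self T)).trans hend
  have h2 : (0 : ℝ) < 2 ^ N := by positivity
  have h3 : (2 : ℝ) ^ N * (N - 4 * T) ≤ 0 := by linarith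
  have := nonpos_of_mul_nonpos_right h3 h2
  linarith

/-- Without queries the output distribution ignores the input, yet the errors on the all-zero and
all-one inputs must add up to at least `1`. -/
theorem queries_pos {q e : ℝ} (hq : 1 ≤ q) (hn : 0 < n) (he : e < 1 / 2)
    (hA : ∀ X, A.expectedError q X ≤ e) : 0 < T := by
  rcases Nat.eq_zero_or_pos T with rfl | h
  swap
  · exact h
  exfalso
  have hn' : (n : ℝ) ≠ 0 := by exact_mod_cast hn.ne'
  have h0 := A.sum_abs_le hq (fun _ => false) (hA _)
  have h1 := A.sum_abs_le hq (fun _ => true) (hA _)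
  have hp : ∀ j, A.prob (fun _ => true) j = A.prob (fun _ => false) j := fun j => rfl
  have m0 : mean (fun _ : Fin n => false) = 0 := by simp [mean, weight]
  have m1 : mean (fun _ : Fin n => true) = 1 := by simp [mean, weight, hn']
  simp only [hp, m0, m1] at h0 h1
  have : ∑ j, A.prob (fun _ => false) j ≤ ∑ j, (A.prob (fun _ => false) j * |0 - A.estimate j|
      + A.prob (fun _ => false) j * |1 - A.estimate j|) := by
    refine Finset.sum_le_sum fun j _ => ?_
    have h := abs_sub_le (1 : ℝ) (A.estimate j) 0
    rw [abs_sub_comm (A.estimate j) 0, sub_zero, abs_one] at h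
    nlinarith [A.prob_nonneg (fun _ => false) j]
  rw [Finset.sum_add_distrib, A.sum_prob] at this
  linarith

end Algorithm

end QuantumCount

/-! ### Choice of the block length and the constant. -/

theorem corollary4p1 :
    ∃ c : ℝ, 0 < c ∧
      ∀ (q : ℝ), 1 ≤ q →
      ∀ (n : ℕ) (Δ : ℝ), 0 < Δ → Δ < (n : ℝ) / 2 →
      ∀ (T : ℕ) (A : QuantumCount.Algorithm n T),
        A.worstExpectedCountError q ≤ Δ →
          c * min ((n : ℝ) / Δ) (n : ℝ) ≤ (T : ℝ) := by
  -- `264 = 8 * 33`, from `n ≤ 8 * d * T` and `d < 32 * Δ + 1 ≤ 33 * max Δ 1`.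
  refine ⟨1 / 264, by norm_num, ?_⟩
  intro q hq n Δ hΔ hΔn T A hA
  have hn' : (0 : ℝ) < n := by linarith
  have hn : 0 < n := by exact_mod_cast hn'
  have hE := A.expectedError_le_of_worst hn hA
  have hd0 : 0 < ⌈32 * Δ⌉₊ := Nat.ceil_pos.2 (by linarith)
  have hd1 : 32 * Δ ≤ (⌈32 * Δ⌉₊ : ℝ) := Nat.le_ceil _
  have hd2 : (⌈32 * Δ⌉₊ : ℝ) < 32 * Δ + 1 := Nat.ceil_lt_add_one (by linarith)
  generalize ⌈32 * Δ⌉₊ = d at hd0 hd1 hd2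
  have hd0' : (0 : ℝ) < d := by exact_mod_cast hd0
  have hT : 0 < T := A.queries_pos hq hn (by rw [div_lt_iff₀ hn']; linarith) hE
  have hT' : (1 : ℝ) ≤ T := by exact_mod_cast hT
  have hN := A.numBlocks_le_queries hq hd0 hn (Nat.div_mul_le_self n d)
    (by positivity) (by rw [← mul_div_assoc]; gcongr) hE
  have hdiv : n < d * (n / d + 1) := by
    simpa [mul_comm] using Nat.lt_mul_div_succ n hd0
  have hdiv' : (n : ℝ) < d * ((n / d : ℕ) + 1) := by exact_mod_cast hdiv
  -- `n < d * (N + 1) ≤ d * (4 * T + 1)`, and `T ≥ 1` absorbs the rounding term.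
  have hnd : (n : ℝ) ≤ d * (8 * T) := by nlinarith
  rcases le_total Δ 1 with h1 | h1
  · have : min ((n : ℝ) / Δ) n ≤ n := min_le_right _ _
    nlinarith
  · have h2 : min ((n : ℝ) / Δ) n ≤ n / Δ := min_le_left _ _
    have h3 : (n : ℝ) / Δ ≤ 264 * T := by
      rw [div_le_iff₀ hΔ]
      nlinarith
    linarith
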